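/- Let $G$ be a finite simple graph on $n\ge 2$ vertices. Write $\mathrm{val}(v)$ for the number of neighbours of $v$, and suppose that $\mathrm{val}(u)+\mathrm{val}(v)\geq n$ for any two adjacent vertices $u,v$, and $\mathrm{val}(u)+\mathrm{val}(v)\geq n+1$ for any two distinct non-adjacent vertices $u,v$ (in particular $G$ is connected). Then $$\mathrm{sn}(G)=\mathrm{gon}(G)=n-\alpha(G).$$ Here $\alpha(G)$ is the maximum size of an independent set of vertices, and the other two invariants are defined as follows. *Scramble number.* A scramble $\mathcal S$ on $G$ is a collection of non-empty vertex sets (eggs), each inducing a connected subgraph. Let $h(\mathcal S)$ be the minimum size of a set $C\subseteq V(G)$ meeting every egg. Let $e(\mathcal S)$ be the minimum number of edges between $A$ and $V(G)\setminus A$ over all $A\subseteq V(G)$ such that both $A$ and $V(G)\setminus A$ contain an egg, with $e(\mathcal S)=\infty$ if there is no such $A$. The scramble number $\mathrm{sn}(G)$ is the maximum of $\min(h(\mathcal S),e(\mathcal S))$ over all scrambles $\mathcal S$ on $G$. *Gonality.* A divisor is a function $D:V(G)\to\mathbb Z$, of degree $\sum_v D(v)$; it is effective if $D(v)\ge 0$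 for all $v$. The chip-firing move at $v$ subtracts $\mathrm{val}(v)$ from $D(v)$ and adds $1$ to $D(w)$ for each neighbour $w$ of $v$. Two divisors are equivalent if a finite sequence of chip-firing moves transforms one into the other. The rank of $D$ is $-1$ if $D$ is not equivalent to an effective divisor; otherwise it is the largest integer $r\ge 0$ such that $D-E$ is equivalent to an effective divisor for every effective divisor $E$ of degree $r$. The gonality $\mathrm{gon}(G)$ is the minimum degree of a divisor of positive rank. -/

import Mathlib

namespace SimpleGraph

variable {V : Type*} [Fintype V] [DecidableEq V] (G : SimpleGraph V)

/-- A scramble on `G`: a collection of connected (in particular non-empty) vertex sets,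
the eggs of the scramble. -/
structure Scramble where
  eggs : Finset (Finset V)
  connected : ∀ E ∈ eggs, (G.induce (E : Set V)).Connected

namespace Scramble

variable {G}

/-- `C` is a hitting set of the scramble if it meets every egg. -/
def IsHittingSet (S : G.Scramble) (C : Finset V) : Prop :=
  ∀ E ∈ S.eggs, (C ∩ E).Nonempty

/-- The minimum size of a hitting set. -/
noncomputable def hittingNumber (S : G.Scramble) : ℕ∞ :=
  ⨅ (C : Finset V) (_ : S.IsHittingSet C), (C.card : ℕ∞)

/-- `A` is an egg-cut if `A` and its complement each contain an egg. -/
def IsEggCut (S : G.Scramble) (A : Finset V) : Prop :=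
  (∃ E ∈ S.eggs, E ⊆ A) ∧ (∃ E ∈ S.eggs, E ⊆ Aᶜ)

/-- The minimum number of edges between `A` and its complement, over all egg-cuts `A`;
it is `⊤` if there is no egg-cut. -/
noncomputable def eggCutNumber [DecidableRel G.Adj] (S : G.Scramble) : ℕ∞ :=
  ⨅ (A : Finset V) (_ : S.IsEggCut A), ((G.interedges A Aᶜ).card : ℕ∞)

/-- The order of a scramble. -/
noncomputable def order [DecidableRel G.Adj] (S : G.Scramble) : ℕ∞ :=
  min S.hittingNumber S.eggCutNumber

end Scramble

/-- The scramble number: the maximum order of a scramble. There are finitely many scrambles,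
and the order is at most the number of vertices, so the supremum is a maximum. -/
noncomputable def scrambleNumber [DecidableRel G.Adj] : ℕ∞ :=
  ⨆ S : G.Scramble, S.order

/-- The result of the chip-firing move at `v`, applied to the divisor `D`. -/
def fire [DecidableRel G.Adj] (v : V) (D : V → ℤ) : V → ℤ := fun w =>
  if w = v then D v - (G.degree v : ℤ) else D w + (if G.Adj v w then 1 else 0)

/-- Two divisors are equivalent if a finite sequence of chip-firing moves transforms the
first into the second. -/
def DivEquiv [DecidableRel G.Adj] : (V → ℤ) → (V → ℤ) → Prop :=
  Relation.ReflTransGen (fun D D' => ∃ v, D' = G.fire v D)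

/-- The divisor `D` is equivalent to some effective divisor. -/
def EquivEffective [DecidableRel G.Adj] (D : V → ℤ) : Prop :=
  ∃ D' : V → ℤ, G.DivEquiv D D' ∧ ∀ v, 0 ≤ D' v

open Classical in
/-- The rank of a divisor: `-1` if it is not equivalent to an effective divisor, and otherwise
the largest natural number `r` such that `D - E` is equivalent to an effective divisor for every
effective divisor `E` of degree `r`. (On a non-empty vertex set such `r` are bounded by the
degree of `D`.) -/
noncomputable def divRank [DecidableRel G.Adj] (D : V → ℤ) : ℤ :=
  if G.EquivEffective D then
    ((sSup {r : ℕ | ∀ E : V → ℤ, (∀ v, 0 ≤ E v) → ∑ v, E v = (r : ℤ) →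
      G.EquivEffective (D - E)} : ℕ) : ℤ)
  else -1

/-- The divisorial gonality: the minimum degree of a divisor of positive rank.
(A divisor of positive rank is equivalent to an effective one, so its degree is non-negative.) -/
noncomputable def gonality [DecidableRel G.Adj] : ℕ :=
  sInf {k : ℕ | ∃ D : V → ℤ, ∑ v, D v = (k : ℤ) ∧ 0 < G.divRank D}

end SimpleGraph

/-!
The proof closes the chain of inequalities `n - α ≤ sn ≤ gon ≤ n - α`.

* `gon ≤ n - α` (`gonality_le`). Put one chip on each vertex outside a maximum independent set
`I`. To bring a chip to `v ∈ I`, fire every vertex other than `v`: each neighbour of `v` loses one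
chip, and these neighbours lie outside `I`. This needs only that no vertex is isolated.

* `sn ≤ gon` (`Scramble.order_le_of_pos_divRank`), which holds for every graph. Let `D` have positive
rank and let `S` be a scramble. If every effective divisor equivalent to `D` has a chip on every
egg, then the support of any of them is a hitting set. Otherwise take, among the effective divisors
equivalent to `D`, one, `D₀`, with chips on as many eggs as possible, an egg `E` without chips, and a
firing script `c` leading from `D₀` to an effective divisor with a chip on `E`. Firing the set `U`
of vertices where `c` is largest keeps the divisor effective. If some egg loses all its chips, it
lies inside `U` by connectedness, while `E` lies outside `U`, so `U` is an egg-cut, and all edges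
leaving `U` were paid for by chips of `D₀`. If no egg loses all its chips, the new divisor is again
maximal and has no chip on `E`, and the largest value of the script has dropped.

* `n - α ≤ sn` (`card_sub_indepNum_le_scrambleNumber`). The scramble whose eggs are the edges works.
A hitting set is a vertex cover, so it has at least `n - α` elements. An egg-cut has at least two
vertices on each side, and a count of the edges leaving the smaller side, vertex by vertex, shows
that the degree conditions force at least `n - 2` edges across it, and at least `n - 1` if the graph
is complete.
-/

namespace SimpleGraph

open Finset Matrix

variable {V : Type*} [Fintype V] [DecidableEq V] {G : SimpleGraph V} [DecidableRel G.Adj]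

/-! ### The Laplacian and chip-firing -/

theorem lapMatrix_mulVec_eq_sum_sub (c : V → ℤ) (v : V) :
    (G.lapMatrix ℤ *ᵥ c) v = ∑ w ∈ G.neighborFinset v, (c v - c w) := by
  rw [lapMatrix_mulVec_apply, sum_sub_distrib, sum_const, card_neighborFinset_eq_degree,
    nsmul_eq_mul]

theorem sum_lapMatrix_mulVec (c : V → ℤ) : ∑ v, (G.lapMatrix ℤ *ᵥ c) v = 0 := by
  have h : (fun _ => (1 : ℤ)) ⬝ᵥ (G.lapMatrix ℤ *ᵥ c) = 0 := by
    rw [dotProduct_mulVec, ← mulVec_transpose, (G.isSymm_lapMatrix (R := ℤ)).eq,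
      lapMatrix_mulVec_const_eq_zero, zero_dotProduct]
  simpa [dotProduct] using h

theorem fire_eq_sub_lapMatrix (v : V) (D : V → ℤ) :
    G.fire v D = D - G.lapMatrix ℤ *ᵥ Pi.single v 1 := by
  ext w
  rw [Pi.sub_apply, lapMatrix_mulVec_apply]
  by_cases hw : w = v
  · subst hw
    simp [fire, Pi.single_apply]
  · by_cases h : G.Adj v w <;>
      simp [fire, hw, Pi.single_apply, h, G.adj_comm w v]

theorem DivEquiv.exists_script {D D' : V → ℤ} (h : G.DivEquiv D D') :
    ∃ c : V → ℤ, D' = D - G.lapMatrix ℤ *ᵥ c := by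
  induction h with
  | refl => exact ⟨0, by simp⟩
  | tail _ h ih =>
    obtain ⟨c, rfl⟩ := ih
    obtain ⟨v, rfl⟩ := h
    exact ⟨c + Pi.single v 1, by rw [fire_eq_sub_lapMatrix, mulVec_add, sub_sub]⟩

theorem divEquiv_fire_set (D : V → ℤ) (U : Finset V) :
    G.DivEquiv D (D - G.lapMatrix ℤ *ᵥ (fun v => if v ∈ U then 1 else 0)) := by
  induction U using Finset.induction_on with
  | empty =>
    have : (fun v : V => if v ∈ (∅ : Finset V) then (1 : ℤ) else 0) = 0 := by ext; simp
    rw [this, mulVec_zero, sub_zero]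
    exact Relation.ReflTransGen.refl
  | insert a U ha ih =>
    refine Relation.ReflTransGen.tail ih ⟨a, ?_⟩
    rw [fire_eq_sub_lapMatrix, sub_sub, ← mulVec_add]
    congr 2
    ext v
    by_cases h : v = a
    · subst h; simp [ha]
    · simp [h]

theorem DivEquiv.sum_eq {D D' : V → ℤ} (h : G.DivEquiv D D') : ∑ v, D' v = ∑ v, D v := by
  obtain ⟨c, rfl⟩ := h.exists_script
  simp [sum_sub_distrib, sum_lapMatrix_mulVec]

theorem EquivEffective.of_nonneg {D : V → ℤ} (h : ∀ v, 0 ≤ D v) : G.EquivEffective D :=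
  ⟨D, Relation.ReflTransGen.refl, h⟩

theorem EquivEffective.sum_nonneg {D : V → ℤ} (h : G.EquivEffective D) : 0 ≤ ∑ v, D v := by
  obtain ⟨D', hD, hpos⟩ := h
  rw [← hD.sum_eq]
  exact Finset.sum_nonneg fun v _ => hpos v

/-! ### Positive rank -/

/-- A divisor of positive rank is equivalent, for each vertex `v`, to an effective divisor with
a chip on `v`. -/
theorem exists_script_of_pos_divRank {D : V → ℤ} (h : 0 < G.divRank D) (v : V) :
    ∃ c : V → ℤ, (∀ w, 0 ≤ (D - G.lapMatrix ℤ *ᵥ c) w) ∧ 0 < (D - G.lapMatrix ℤ *ᵥ c) v := by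
  unfold divRank at h
  split_ifs at h with hD
  · set R : Set ℕ := {r : ℕ | ∀ E : V → ℤ, (∀ v, 0 ≤ E v) → ∑ v, E v = (r : ℤ) →
      G.EquivEffective (D - E)}
    have hpos : 0 < sSup R := by exact_mod_cast h
    -- A natural supremum is nonzero only if it is attained.
    have hbdd : BddAbove R := by
      by_contra hb
      rw [Nat.sSup_of_not_bddAbove hb] at hpos
      exact lt_irrefl _ hpos
    have hne : R.Nonempty := by
      by_contra hb
      rw [Set.not_nonempty_iff_eq_empty] at hb
      simp [hb] at hpos
    have hmem := Nat.sSup_mem hne hbdd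
    obtain ⟨D', hD', hnn⟩ := hmem (Pi.single v ((sSup R : ℕ) : ℤ))
      (fun w => by by_cases hw : w = v <;> simp [hw]) (by simp)
    obtain ⟨c, rfl⟩ := hD'.exists_script
    have hE : ∀ w, (D - G.lapMatrix ℤ *ᵥ c) w =
        (D - (Pi.single v ((sSup R : ℕ) : ℤ) : V → ℤ) - G.lapMatrix ℤ *ᵥ c) w +
          (Pi.single v ((sSup R : ℕ) : ℤ) : V → ℤ) w := by
      intro w; simp only [Pi.sub_apply]; ring
    refine ⟨c, fun w => ?_, ?_⟩
    · rw [hE]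
      refine add_nonneg (hnn w) ?_
      by_cases hw : w = v <;> simp [hw]
    · rw [hE]
      refine add_pos_of_nonneg_of_pos (hnn v) ?_
      simpa using hpos
  · omega

theorem pos_divRank_of_forall [Nonempty V] {D : V → ℤ} (hD : G.EquivEffective D)
    (h : ∀ v, G.EquivEffective (D - Pi.single v 1)) : 0 < G.divRank D := by
  unfold divRank
  rw [if_pos hD]
  have hbdd : BddAbove {r : ℕ | ∀ E : V → ℤ, (∀ v, 0 ≤ E v) → ∑ v, E v = (r : ℤ) →
      G.EquivEffective (D - E)} := by
    refine ⟨(∑ v, D v).toNat, fun r hr => ?_⟩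
    obtain ⟨v⟩ := ‹Nonempty V›
    have := (hr (Pi.single v (r : ℤ))
      (fun w => by by_cases hw : w = v <;> simp [hw]) (by simp)).sum_nonneg
    simp only [Pi.sub_apply, sum_sub_distrib, sum_pi_single', mem_univ, if_true] at this
    omega
  refine Int.natCast_pos.mpr (lt_of_lt_of_le Nat.zero_lt_one (le_csSup hbdd ?_))
  intro E hE hsum
  -- An effective divisor of degree one is a single chip.
  obtain ⟨v, -, hv⟩ : ∃ v ∈ univ, 0 < E v := by
    by_contra! hcon
    have := Finset.sum_nonpos hcon
    simp [hsum] at this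
  have hEv : E = Pi.single v 1 := by
    have hs := Finset.add_sum_erase univ E (mem_univ v)
    have hrest : 0 ≤ ∑ w ∈ univ.erase v, E w := Finset.sum_nonneg fun w _ => hE w
    have h1 : E v = 1 := by push_cast at hsum; omega
    have h0 : ∑ w ∈ univ.erase v, E w = 0 := by push_cast at hsum; omega
    rw [Finset.sum_eq_zero_iff_of_nonneg fun w _ => hE w] at h0
    ext w
    by_cases hw : w = v
    · subst hw; simpa using h1
    · simpa [hw] using h0 w (by simp [hw])
  rw [hEv]
  exact h v

/-! ### The gonality is at most `n - α` -/

/-- One chip on each vertex outside an independent set gives positive rank, if no vertex is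
isolated. -/
theorem IsIndepSet.pos_divRank [Nonempty V] {I : Finset V} (hI : G.IsIndepSet (I : Set V))
    (hdeg : ∀ v, 0 < G.degree v) : 0 < G.divRank (fun v => if v ∈ I then 0 else 1) := by
  refine pos_divRank_of_forall (EquivEffective.of_nonneg fun v => by split_ifs <;> simp) ?_
  intro v
  by_cases hv : v ∈ I
  · refine ⟨_, divEquiv_fire_set _ (univ.erase v), fun w => ?_⟩
    rw [Pi.sub_apply, Pi.sub_apply, lapMatrix_mulVec_eq_sum_sub]
    by_cases hw : w = v
    · subst hw
      have hs : ∑ x ∈ G.neighborFinset w, ((if w ∈ univ.erase w then (1 : ℤ) else 0) -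
          (if x ∈ univ.erase w then 1 else 0)) = -(G.degree w : ℤ) := by
        rw [Finset.sum_congr rfl (g := fun _ => (-1 : ℤ))]
        · simp
        · intro x hx
          have : x ≠ w := (G.ne_of_adj ((G.mem_neighborFinset w x).1 hx)).symm
          simp [this]
      have := hdeg w
      rw [hs]
      simp [hv]
      omega
    · have hs : ∑ x ∈ G.neighborFinset w, ((if w ∈ univ.erase v then (1 : ℤ) else 0) -
          (if x ∈ univ.erase v then 1 else 0)) = if G.Adj w v then 1 else 0 := by
        rw [Finset.sum_congr rfl (g := fun x => if x = v then (1 : ℤ) else 0)]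
        · simp
        · intro x _
          by_cases hx : x = v <;> simp [hx, hw]
      rw [hs]
      by_cases ha : G.Adj w v
      · have : w ∉ I := fun hwI => hI hwI hv hw ha
        simp [ha, this, hw]
      · simp [ha, hw]
        split_ifs <;> simp
  · refine EquivEffective.of_nonneg fun w => ?_
    by_cases hw : w = v
    · subst hw; simp [hv]
    · simp [hw]
      split_ifs <;> simp

theorem exists_pos_divRank [Nonempty V] (hdeg : ∀ v, 0 < G.degree v) :
    ∃ D : V → ℤ, ∑ v, D v = ((Fintype.card V - G.indepNum : ℕ) : ℤ) ∧ 0 < G.divRank D := by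
  obtain ⟨I, hI, hcard⟩ := G.exists_isNIndepSet_indepNum
  refine ⟨_, ?_, hI.pos_divRank hdeg⟩
  rw [← hcard, ← card_compl]
  simp_rw [← ite_not (_ ∈ I), ← mem_compl]
  simp [-mem_compl]

theorem gonality_le [Nonempty V] (hdeg : ∀ v, 0 < G.degree v) :
    G.gonality ≤ Fintype.card V - G.indepNum :=
  Nat.sInf_le (exists_pos_divRank hdeg)

/-! ### Edges leaving a vertex set -/

theorem card_interedges_compl (A : Finset V) :
    (G.interedges A Aᶜ).card = ∑ v ∈ A, (G.neighborFinset v \ A).card := by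
  rw [interedges_def, card_filter, sum_product]
  refine Finset.sum_congr rfl fun v _ => ?_
  rw [← card_filter]
  congr 1
  ext w
  simp [and_comm]

theorem card_interedges_compl_compl (A : Finset V) :
    (G.interedges Aᶜ Aᶜᶜ).card = (G.interedges A Aᶜ).card := by
  rw [compl_compl]
  have := G.symm
  exact Rel.card_interedges_comm (r := G.Adj) _ _

omit [Fintype V] [DecidableEq V] [DecidableRel G.Adj] in
/-- A connected vertex set that meets `U` without lying inside it contains an edge leaving `U`. -/
theorem exists_adj_of_connected_induce {E : Finset V} (hE : (G.induce (E : Set V)).Connected)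
    {U : Finset V} {x y : V} (hx : x ∈ E) (hxU : x ∈ U) (hy : y ∈ E) (hyU : y ∉ U) :
    ∃ u w, u ∈ E ∧ w ∈ E ∧ u ∈ U ∧ w ∉ U ∧ G.Adj u w := by
  obtain ⟨p⟩ := hE.preconnected ⟨x, hx⟩ ⟨y, hy⟩
  obtain ⟨d, -, h1, h2⟩ := p.exists_boundary_dart {z | (z : V) ∈ U} hxU hyU
  exact ⟨d.fst, d.snd, d.fst.2, d.snd.2, h1, h2, d.adj⟩

/-! ### Firing a vertex set -/

theorem fire_set_apply_of_mem (D : V → ℤ) {U : Finset V} {v : V} (hv : v ∈ U) :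
    (D - G.lapMatrix ℤ *ᵥ (fun v => if v ∈ U then 1 else 0)) v =
      D v - (G.neighborFinset v \ U).card := by
  rw [Pi.sub_apply, lapMatrix_mulVec_eq_sum_sub]
  congr 1
  rw [card_eq_sum_ones, sdiff_eq_filter, sum_filter]
  push_cast
  refine Finset.sum_congr rfl fun w _ => ?_
  by_cases hw : w ∈ U <;> simp [hv, hw]

theorem fire_set_apply_of_notMem (D : V → ℤ) {U : Finset V} {v : V} (hv : v ∉ U) :
    (D - G.lapMatrix ℤ *ᵥ (fun v => if v ∈ U then 1 else 0)) v =
      D v + (G.neighborFinset v ∩ U).card := by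
  rw [Pi.sub_apply, lapMatrix_mulVec_eq_sum_sub, sub_eq_add_neg, ← sum_neg_distrib]
  congr 1
  rw [card_eq_sum_ones, ← filter_mem_eq_inter, sum_filter]
  push_cast
  refine Finset.sum_congr rfl fun w _ => ?_
  by_cases hw : w ∈ U <;> simp [hv, hw]

/-- Firing the set where a script attains its largest value keeps a divisor effective, if the
whole script does. -/
theorem fire_top_level_nonneg {D c : V → ℤ} {m : ℤ} (hD : ∀ v, 0 ≤ D v)
    (hDc : ∀ v, 0 ≤ (D - G.lapMatrix ℤ *ᵥ c) v) (hc : ∀ v, c v ≤ m) (v : V) :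
    0 ≤ (D - G.lapMatrix ℤ *ᵥ (fun v => if v ∈ univ.filter (c · = m) then 1 else 0)) v := by
  by_cases hv : v ∈ univ.filter (c · = m)
  · refine (hDc v).trans ?_
    rw [Pi.sub_apply, Pi.sub_apply, lapMatrix_mulVec_eq_sum_sub, lapMatrix_mulVec_eq_sum_sub]
    refine sub_le_sub_left (Finset.sum_le_sum fun w _ => ?_) _
    have hw := hc w
    simp only [mem_filter, mem_univ, true_and] at hv ⊢
    split_ifs <;> omega
  · rw [fire_set_apply_of_notMem D hv]
    exact add_nonneg (hD v) (by positivity)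

/-! ### The scramble number is at most the gonality -/

namespace Scramble

/-- The eggs of a scramble that carry a chip of the divisor `D`. -/
def hitEggs (S : G.Scramble) (D : V → ℤ) : Finset (Finset V) :=
  S.eggs.filter fun E => ∃ v ∈ E, 0 < D v

omit [Fintype V] [DecidableEq V] [DecidableRel G.Adj] in
theorem mem_hitEggs {S : G.Scramble} {D : V → ℤ} {E : Finset V} :
    E ∈ S.hitEggs D ↔ E ∈ S.eggs ∧ ∃ v ∈ E, 0 < D v := mem_filter

omit [DecidableRel G.Adj] in
/-- The vertices with a chip form a hitting set if every egg carries a chip. -/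
theorem hittingNumber_le_of_hitEggs_eq {S : G.Scramble} {D : V → ℤ} (hD : ∀ v, 0 ≤ D v)
    (h : ∀ E ∈ S.eggs, E ∈ S.hitEggs D) {k : ℕ} (hk : ∑ v, D v = k) : S.hittingNumber ≤ k := by
  have hhit : S.IsHittingSet (univ.filter (0 < D ·)) := by
    intro E hE
    obtain ⟨v, hv, hpos⟩ := (mem_hitEggs.1 (h E hE)).2
    exact ⟨v, by simp [hv, hpos]⟩
  refine (iInf₂_le _ hhit).trans ?_
  have : ((univ.filter (0 < D ·)).card : ℤ) ≤ k := by
    rw [← hk, card_filter]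
    push_cast
    refine Finset.sum_le_sum fun v _ => ?_
    have := hD v
    split_ifs <;> omega
  exact_mod_cast this

/-- Suppose that no effective divisor equivalent to `D` has chips on more eggs than `D`, and that
the script `c` leads from `D` to an effective divisor with a chip on an egg `E` on which `D` has
none. Then some egg-cut has at most `deg D` edges. -/
theorem eggCutNumber_le_of_script {S : G.Scramble} {E : Finset V} (hE : E ∈ S.eggs) {k : ℕ}
    (N : ℕ) : ∀ D c : V → ℤ, ∑ v, D v = k → (∀ v, 0 ≤ D v) →
      (∀ c' : V → ℤ, (∀ v, 0 ≤ (D - G.lapMatrix ℤ *ᵥ c') v) →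
        (S.hitEggs (D - G.lapMatrix ℤ *ᵥ c')).card ≤ (S.hitEggs D).card) →
      (∀ v, 0 ≤ c v) → (∀ v, c v ≤ N) → (∀ v, 0 ≤ (D - G.lapMatrix ℤ *ᵥ c) v) →
      E ∉ S.hitEggs D → E ∈ S.hitEggs (D - G.lapMatrix ℤ *ᵥ c) → S.eggCutNumber ≤ k := by
  induction N with
  | zero =>
    intro D c _ _ _ hc0 hcN _ hED hEc
    have : c = 0 := by
      ext v
      have h0 := hc0 v
      have h1 := hcN v
      simp only [Nat.cast_zero] at h1
      exact le_antisymm h1 h0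
    rw [this, mulVec_zero, sub_zero] at hEc
    exact absurd hEc hED
  | succ N ih =>
    intro D c hdeg hD hmax hc0 hcN hDc hED hEc
    set U : Finset V := univ.filter (c · = ((N + 1 : ℕ) : ℤ)) with hU
    set i : V → ℤ := fun v => if v ∈ U then 1 else 0 with hi
    have hD1 : ∀ v, 0 ≤ (D - G.lapMatrix ℤ *ᵥ i) v := fire_top_level_nonneg hD hDc hcN
    have hED0 : ∀ v ∈ E, D v = 0 := by
      intro v hv
      refine le_antisymm (not_lt.1 fun hpos => hED (mem_hitEggs.2 ⟨hE, v, hv, hpos⟩)) (hD v)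
    -- A vertex of `E ∩ U` with a neighbour outside `U` would have to give away a chip, and if
    -- `E` were contained in `U`, the script would bring no chip to `E`.
    have hEU : E ⊆ Uᶜ := by
      intro x hx
      rw [mem_compl]
      intro hxU
      by_cases hsub : E ⊆ U
      · obtain ⟨-, v, hv, hpos⟩ := mem_hitEggs.1 hEc
        have hcv : c v = ((N + 1 : ℕ) : ℤ) := (mem_filter.1 (hsub hv)).2
        rw [Pi.sub_apply, lapMatrix_mulVec_eq_sum_sub, hED0 v hv] at hpos
        have : 0 ≤ ∑ w ∈ G.neighborFinset v, (c v - c w) :=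
          Finset.sum_nonneg fun w _ => by rw [hcv]; exact sub_nonneg.2 (hcN w)
        omega
      · obtain ⟨y, hy, hyU⟩ := Finset.not_subset.1 hsub
        obtain ⟨u, w, hu, -, huU, hwU, huw⟩ :=
          exists_adj_of_connected_induce (S.connected E hE) hx hxU hy hyU
        have h := hD1 u
        rw [hi, fire_set_apply_of_mem D huU, hED0 u hu] at h
        have : 0 < (G.neighborFinset u \ U).card := card_pos.2 ⟨w, by simp [huw, hwU]⟩
        omega
    by_cases hlost : S.hitEggs D ⊆ S.hitEggs (D - G.lapMatrix ℤ *ᵥ i)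
    · have heq : S.hitEggs D = S.hitEggs (D - G.lapMatrix ℤ *ᵥ i) :=
        eq_of_subset_of_card_le hlost (hmax i hD1)
      have hadd : ∀ c' : V → ℤ, D - G.lapMatrix ℤ *ᵥ i - G.lapMatrix ℤ *ᵥ c' =
          D - G.lapMatrix ℤ *ᵥ (i + c') := fun c' => by rw [mulVec_add, sub_sub]
      refine ih (D - G.lapMatrix ℤ *ᵥ i) (c - i) ?_ hD1 ?_ ?_ ?_ ?_ ?_ ?_
      · simp [sum_sub_distrib, sum_lapMatrix_mulVec, hdeg]
      · intro c' hc'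
        rw [hadd] at hc' ⊢
        rw [← heq]
        exact hmax _ hc'
      · intro v
        have h0 := hc0 v
        by_cases hv : v ∈ U
        · have : c v = ((N + 1 : ℕ) : ℤ) := (mem_filter.1 hv).2
          simp [hi, hv, this]
        · simpa [hi, hv] using h0
      · intro v
        have h1 := hcN v
        by_cases hv : v ∈ U
        · have : c v = ((N + 1 : ℕ) : ℤ) := (mem_filter.1 hv).2
          simp [hi, hv, this]
        · have : c v ≠ ((N + 1 : ℕ) : ℤ) := fun h => hv (by simp [hU, h])
          simp only [hi, hv, Pi.sub_apply, if_false]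
          omega
      · rw [hadd, add_sub_cancel]
        exact hDc
      · rw [← heq]
        exact hED
      · rw [hadd, add_sub_cancel]
        exact hEc
    · obtain ⟨F, hFD, hF1⟩ := Finset.not_subset.1 hlost
      obtain ⟨hF, x, hx, hxpos⟩ := mem_hitEggs.1 hFD
      have hF0 : ∀ v ∈ F, (D - G.lapMatrix ℤ *ᵥ i) v ≤ 0 := fun v hv =>
        not_lt.1 fun hpos => hF1 (mem_hitEggs.2 ⟨hF, v, hv, hpos⟩)
      have hxU : x ∈ U := by
        by_contra hxU
        have h := hF0 x hx
        rw [hi, fire_set_apply_of_notMem D hxU] at h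
        omega
      -- An edge of `F` leaving `U` would bring a chip to a vertex of `F`.
      have hFU : F ⊆ U := by
        by_contra hsub
        obtain ⟨y, hy, hyU⟩ := Finset.not_subset.1 hsub
        obtain ⟨u, w, -, hw, huU, hwU, huw⟩ :=
          exists_adj_of_connected_induce (S.connected F hF) hx hxU hy hyU
        have h := hF0 w hw
        rw [hi, fire_set_apply_of_notMem D hwU] at h
        have : 0 < (G.neighborFinset w ∩ U).card := card_pos.2 ⟨u, by simp [huw.symm, huU]⟩
        have := hD w
        omega
      have hcut : S.IsEggCut U := ⟨⟨F, hF, hFU⟩, ⟨E, hE, hEU⟩⟩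
      refine (iInf₂_le _ hcut).trans ?_
      have : ((G.interedges U Uᶜ).card : ℤ) ≤ k := by
        rw [card_interedges_compl, ← hdeg]
        push_cast
        calc ∑ v ∈ U, ((G.neighborFinset v \ U).card : ℤ) ≤ ∑ v ∈ U, D v := by
              refine Finset.sum_le_sum fun v hv => ?_
              have h := hD1 v
              rw [hi, fire_set_apply_of_mem D hv] at h
              omega
          _ ≤ ∑ v, D v := Finset.sum_le_sum_of_subset_of_nonneg (subset_univ U)
              fun v _ _ => hD v
      exact_mod_cast this

theorem order_le_of_pos_divRank [Nonempty V] (S : G.Scramble) {D : V → ℤ} {k : ℕ}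
    (hk : ∑ v, D v = k) (hD : 0 < G.divRank D) : S.order ≤ k := by
  classical
  let P : ℕ → Prop := fun m => ∃ c : V → ℤ, (∀ v, 0 ≤ (D - G.lapMatrix ℤ *ᵥ c) v) ∧
    (S.hitEggs (D - G.lapMatrix ℤ *ᵥ c)).card = m
  have hex : ∃ m, P m := by
    obtain ⟨v⟩ := ‹Nonempty V›
    obtain ⟨c, hc, -⟩ := exists_script_of_pos_divRank hD v
    exact ⟨_, c, hc, rfl⟩
  have hPb : ∀ m, P m → m ≤ S.eggs.card := by
    rintro m ⟨c, -, rfl⟩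
    exact card_filter_le _ _
  obtain ⟨m0, hm0⟩ := hex
  obtain ⟨c₀, hc₀, hc₀m⟩ : P (Nat.findGreatest P S.eggs.card) :=
    Nat.findGreatest_spec (hPb m0 hm0) hm0
  set D₀ := D - G.lapMatrix ℤ *ᵥ c₀ with hD₀
  have hdeg : ∑ v, D₀ v = k := by
    simp [hD₀, sum_sub_distrib, sum_lapMatrix_mulVec, hk]
  by_cases hall : ∀ E ∈ S.eggs, E ∈ S.hitEggs D₀
  · exact (min_le_left _ _).trans (hittingNumber_le_of_hitEggs_eq hc₀ hall hdeg)
  · push Not at hall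
    obtain ⟨E, hE, hED⟩ := hall
    obtain ⟨⟨v, hv⟩⟩ := (S.connected E hE).nonempty
    obtain ⟨c₁, hc₁, hpos⟩ := exists_script_of_pos_divRank hD v
    -- Adding a constant makes the script from `D₀` non-negative without changing its effect.
    obtain ⟨M, hM⟩ : ∃ M : ℤ, ∀ w, M ≤ (c₁ - c₀) w := by
      obtain ⟨M, hM⟩ := (Set.finite_range (c₁ - c₀)).bddBelow
      exact ⟨M, fun w => hM ⟨w, rfl⟩⟩
    obtain ⟨N, hN⟩ : ∃ N : ℤ, ∀ w, (c₁ - c₀) w ≤ N := by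
      obtain ⟨N, hN⟩ := (Set.finite_range (c₁ - c₀)).bddAbove
      exact ⟨N, fun w => hN ⟨w, rfl⟩⟩
    have hconst : G.lapMatrix ℤ *ᵥ (fun _ => M) = 0 := by
      ext w
      simp [lapMatrix_mulVec_eq_sum_sub]
    have hc : D₀ - G.lapMatrix ℤ *ᵥ (c₁ - c₀ - fun _ => M) = D - G.lapMatrix ℤ *ᵥ c₁ := by
      rw [mulVec_sub, mulVec_sub, hconst, hD₀]
      abel
    refine (min_le_right _ _).trans (eggCutNumber_le_of_script hE (N - M).toNat D₀
      (c₁ - c₀ - fun _ => M) hdeg hc₀ ?_ ?_ ?_ ?_ hED ?_)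
    · intro c' hc'
      rw [hc₀m]
      refine Nat.le_findGreatest (card_filter_le _ _) ⟨c₀ + c', ?_⟩
      rw [mulVec_add, ← sub_sub]
      exact ⟨hc', rfl⟩
    · intro w
      have := hM w
      rw [Pi.sub_apply]
      omega
    · intro w
      have := hN w
      rw [Pi.sub_apply]
      omega
    · rw [hc]
      exact hc₁
    · rw [hc]
      exact mem_hitEggs.2 ⟨hE, v, hv, hpos⟩

end Scramble

/-- The scramble number bounds the gonality from below. The gonality is an infimum in `ℕ`, so some
divisor of positive rank has to exist; this is why isolated vertices are excluded. -/
theorem scrambleNumber_le_gonality [Nonempty V] (hdeg : ∀ v, 0 < G.degree v) :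
    G.scrambleNumber ≤ G.gonality := by
  obtain ⟨D, hk, hD⟩ : G.gonality ∈ {k : ℕ | ∃ D : V → ℤ, ∑ v, D v = (k : ℤ) ∧ 0 < G.divRank D} :=
    Nat.sInf_mem ⟨_, exists_pos_divRank hdeg⟩
  exact iSup_le fun S => S.order_le_of_pos_divRank hk hD

/-! ### The scramble of edges -/

variable (G) in
/-- The scramble whose eggs are the pairs of adjacent vertices. -/
def edgeScramble : G.Scramble where
  eggs := univ.filter fun E => ∃ u v, G.Adj u v ∧ E = {u, v}
  connected := by
    intro E hE
    obtain ⟨u, v, huv, rfl⟩ := (mem_filter.1 hE).2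
    rw [coe_pair]
    exact induce_pair_connected_of_adj huv

theorem pair_mem_edgeScramble {u v : V} (h : G.Adj u v) : {u, v} ∈ G.edgeScramble.eggs :=
  mem_filter.2 ⟨mem_univ _, u, v, h, rfl⟩

/-- A hitting set of the scramble of edges is a vertex cover, so its complement is independent. -/
theorem card_sub_indepNum_le_hittingNumber :
    ((Fintype.card V - G.indepNum : ℕ) : ℕ∞) ≤ G.edgeScramble.hittingNumber := by
  refine le_iInf₂ fun C hC => ?_
  have hind : G.IsIndepSet ((Cᶜ : Finset V) : Set V) := by
    intro u hu v hv _ huv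
    obtain ⟨x, hx⟩ := hC _ (pair_mem_edgeScramble huv)
    simp only [mem_inter, mem_insert, mem_singleton] at hx
    simp only [coe_compl, Set.mem_compl_iff, mem_coe] at hu hv
    rcases hx with ⟨hxC, rfl | rfl⟩
    · exact hu hxC
    · exact hv hxC
  have := hind.card_le_indepNum
  rw [card_compl] at this
  exact_mod_cast (by omega : Fintype.card V - G.indepNum ≤ C.card)

/-- A vertex has at most `|A| - 1` neighbours in a set `A` containing it. -/
theorem degree_add_one_le {A : Finset V} {v : V} (hv : v ∈ A) :
    G.degree v + 1 ≤ (G.neighborFinset v \ A).card + A.card := by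
  have h1 : G.degree v = (G.neighborFinset v \ A).card + (G.neighborFinset v ∩ A).card := by
    rw [card_sdiff_add_card_inter, card_neighborFinset_eq_degree]
  have h2 : (G.neighborFinset v ∩ A).card < A.card := by
    refine card_lt_card ⟨inter_subset_right, fun hsub => ?_⟩
    have := hsub hv
    simp at this
  omega

omit [Fintype V] in
/-- Apart from an element `u` where `f` is smallest, every `v ∈ A` satisfies `2 f v ≥ s`, and
the deficit at `u` is made up by any one other element. -/
theorem card_mul_le_two_mul_sum {A : Finset V} (hA : 2 ≤ A.card) {f : V → ℕ} {s : ℕ}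
    (h : ∀ u ∈ A, ∀ v ∈ A, u ≠ v → s ≤ f u + f v) : A.card * s ≤ 2 * ∑ v ∈ A, f v := by
  obtain ⟨u, hu, hmin⟩ := A.exists_min_image f (card_pos.1 (by omega))
  obtain ⟨w, hw, hwu⟩ := exists_mem_ne (by omega : 1 < A.card) u
  have hw' : w ∈ A.erase u := mem_erase.2 ⟨hwu, hw⟩
  have h1 := Finset.add_sum_erase A f hu
  have h2 := Finset.add_sum_erase (A.erase u) f hw'
  have h3 : ((A.erase u).erase w).card * s ≤ ∑ v ∈ (A.erase u).erase w, 2 * f v := by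
    rw [← smul_eq_mul]
    refine Finset.card_nsmul_le_sum _ _ _ fun v hv => ?_
    have hv2 := mem_erase.1 (mem_erase.1 hv).2
    have := h u hu v hv2.2 hv2.1.symm
    have := hmin v hv2.2
    omega
  rw [← mul_sum] at h3
  have h4 := h u hu w hw hwu.symm
  obtain ⟨r, hr⟩ : ∃ r, A.card = r + 2 := ⟨A.card - 2, by omega⟩
  have h5 : ((A.erase u).erase w).card = r := by
    rw [card_erase_of_mem hw', card_erase_of_mem hu]; omega
  rw [h5] at h3
  rw [hr, add_mul]
  omega

/-- If some vertex of `A` has at most one neighbour outside `A`, then every vertex outside `A`, with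
at most one exception, is not adjacent to it and so has at least two neighbours in `A`. -/
theorem two_mul_le_card_interedges_of_le_one
    (hnonadj : ∀ u v : V, u ≠ v → ¬ G.Adj u v →
      Fintype.card V + 1 ≤ G.degree u + G.degree v) {A : Finset V} {u : V} (hu : u ∈ A)
    (hu1 : (G.neighborFinset u \ A).card ≤ 1) :
    2 * (Aᶜ.card - 1) ≤ (G.interedges A Aᶜ).card := by
  rw [← card_interedges_compl_compl, card_interedges_compl]
  have hsub : Aᶜ \ (G.neighborFinset u \ A) ⊆ Aᶜ := sdiff_subset
  have hcard : Aᶜ.card - 1 ≤ (Aᶜ \ (G.neighborFinset u \ A)).card := by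
    have := le_card_sdiff (G.neighborFinset u \ A) Aᶜ
    omega
  calc 2 * (Aᶜ.card - 1) ≤ (Aᶜ \ (G.neighborFinset u \ A)).card • 2 := by
        rw [smul_eq_mul]; omega
    _ ≤ ∑ v ∈ Aᶜ \ (G.neighborFinset u \ A), (G.neighborFinset v \ Aᶜ).card := by
        refine Finset.card_nsmul_le_sum _ _ _ fun v hv => ?_
        have hvA := hsub hv
        have hvA' : v ∉ A := mem_compl.1 hvA
        have hna : ¬ G.Adj u v := by
          intro hadj
          exact (mem_sdiff.1 hv).2 (by simp [hadj, hvA'])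
        have h1 := hnonadj u v (fun h => hvA' (h ▸ hu)) hna
        have h2 := degree_add_one_le (G := G) hu
        have h3 := degree_add_one_le (G := G) hvA
        have h4 := card_add_card_compl A
        omega
    _ ≤ _ := Finset.sum_le_sum_of_subset hsub

/-- Under the degree conditions, at least `n - 2` edges leave a set of at least two and at most
half of the vertices. -/
theorem card_sub_two_le_card_interedges
    (hadj : ∀ u v : V, G.Adj u v → Fintype.card V ≤ G.degree u + G.degree v)
    (hnonadj : ∀ u v : V, u ≠ v → ¬ G.Adj u v →
      Fintype.card V + 1 ≤ G.degree u + G.degree v)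
    {A : Finset V} (hA : 2 ≤ A.card) (hle : A.card ≤ Aᶜ.card) :
    Fintype.card V - 2 ≤ (G.interedges A Aᶜ).card := by
  have hcard := card_add_card_compl A
  have hpair : ∀ u ∈ A, ∀ v ∈ A, u ≠ v → Aᶜ.card - A.card + 2 ≤
      (G.neighborFinset u \ A).card + (G.neighborFinset v \ A).card := by
    intro u hu v hv huv
    have h1 := degree_add_one_le (G := G) hu
    have h2 := degree_add_one_le (G := G) hv
    have h3 : Fintype.card V ≤ G.degree u + G.degree v := by
      by_cases h : G.Adj u v
      · exact hadj u v h
      · exact (Nat.le_succ _).trans (hnonadj u v huv h)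
    omega
  have hsum := card_mul_le_two_mul_sum hA hpair
  rw [← card_interedges_compl] at hsum
  obtain ⟨t, ht⟩ := Nat.exists_eq_add_of_le hle
  rw [ht, Nat.add_sub_cancel_left] at hsum
  by_cases ht2 : 2 ≤ t
  · -- `2 (n - 2) = 2 (2 |A| + t - 2) ≤ |A| (t + 2)`, as `(|A| - 2) (t - 2) ≥ 0`.
    obtain ⟨a, ha⟩ := Nat.exists_eq_add_of_le hA
    obtain ⟨b, rfl⟩ := Nat.exists_eq_add_of_le ht2
    rw [ha] at hsum ht hcard
    have : (2 + a) * (2 + b + 2) = 8 + 4 * a + 2 * b + a * b := by ring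
    have := Nat.zero_le (a * b)
    omega
  · by_cases hone : ∃ u ∈ A, (G.neighborFinset u \ A).card ≤ 1
    · obtain ⟨u, hu, hu1⟩ := hone
      have := two_mul_le_card_interedges_of_le_one hnonadj hu hu1
      omega
    · push Not at hone
      have : A.card • 2 ≤ ∑ v ∈ A, (G.neighborFinset v \ A).card :=
        Finset.card_nsmul_le_sum _ _ _ fun v hv => hone v hv
      rw [← card_interedges_compl, smul_eq_mul] at this
      omega

/-- In a graph without two non-adjacent vertices, every edge that can cross `A` does. -/
theorem card_sub_one_le_card_interedges_of_indepNum_le_one (hind : G.indepNum ≤ 1) {A : Finset V}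
    (hA : 1 ≤ A.card) (hA' : 1 ≤ Aᶜ.card) : Fintype.card V - 1 ≤ (G.interedges A Aᶜ).card := by
  have hcomplete : ∀ u v : V, u ≠ v → G.Adj u v := by
    intro u v huv
    by_contra hna
    have hI : G.IsIndepSet (({u, v} : Finset V) : Set V) := by
      rw [coe_pair]
      rintro x (rfl | rfl) y (rfl | rfl) hxy
      · exact absurd rfl hxy
      · exact hna
      · exact fun h => hna h.symm
      · exact absurd rfl hxy
    have := hI.card_le_indepNum
    rw [card_pair huv] at this
    omega
  have hall : G.interedges A Aᶜ = A ×ˢ Aᶜ := by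
    rw [interedges_def]
    refine filter_true_of_mem fun x hx => hcomplete _ _ fun h => ?_
    rw [mem_product, mem_compl] at hx
    exact hx.2 (h ▸ hx.1)
  rw [hall, card_product]
  have hcard := card_add_card_compl A
  obtain ⟨a, ha⟩ := Nat.exists_eq_add_of_le hA
  obtain ⟨b, hb⟩ := Nat.exists_eq_add_of_le hA'
  rw [ha, hb] at hcard ⊢
  have : (1 + a) * (1 + b) = 1 + a + b + a * b := by ring
  have := Nat.zero_le (a * b)
  omega

theorem card_sub_indepNum_le_eggCutNumber [Nonempty V]
    (hadj : ∀ u v : V, G.Adj u v → Fintype.card V ≤ G.degree u + G.degree v)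
    (hnonadj : ∀ u v : V, u ≠ v → ¬ G.Adj u v →
      Fintype.card V + 1 ≤ G.degree u + G.degree v) :
    ((Fintype.card V - G.indepNum : ℕ) : ℕ∞) ≤ G.edgeScramble.eggCutNumber := by
  refine le_iInf₂ fun A hA => ?_
  have htwo : ∀ B : Finset V, (∃ E ∈ G.edgeScramble.eggs, E ⊆ B) → 2 ≤ B.card := by
    rintro B ⟨E, hE, hEB⟩
    obtain ⟨u, v, huv, rfl⟩ := (mem_filter.1 hE).2
    rw [← card_pair (G.ne_of_adj huv)]
    exact card_le_card hEB
  have hA1 := htwo _ hA.1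
  have hA2 := htwo _ hA.2
  have hpos : 1 ≤ G.indepNum := by
    obtain ⟨v⟩ := ‹Nonempty V›
    have hI : G.IsIndepSet (({v} : Finset V) : Set V) := by simp [IsIndepSet]
    simpa using hI.card_le_indepNum
  refine Nat.cast_le.2 ?_
  by_cases hind : G.indepNum ≤ 1
  · have := card_sub_one_le_card_interedges_of_indepNum_le_one hind (A := A) (by omega) (by omega)
    omega
  · have : Fintype.card V - 2 ≤ (G.interedges A Aᶜ).card := by
      rcases le_total A.card Aᶜ.card with hle | hle
      · exact card_sub_two_le_card_interedges hadj hnonadj hA1 hle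
      · rw [← card_interedges_compl_compl]
        exact card_sub_two_le_card_interedges hadj hnonadj hA2 (by rwa [compl_compl])
    omega

theorem card_sub_indepNum_le_scrambleNumber [Nonempty V]
    (hadj : ∀ u v : V, G.Adj u v → Fintype.card V ≤ G.degree u + G.degree v)
    (hnonadj : ∀ u v : V, u ≠ v → ¬ G.Adj u v →
      Fintype.card V + 1 ≤ G.degree u + G.degree v) :
    ((Fintype.card V - G.indepNum : ℕ) : ℕ∞) ≤ G.scrambleNumber :=
  (le_min card_sub_indepNum_le_hittingNumber
    (card_sub_indepNum_le_eggCutNumber hadj hnonadj)).trans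
      (le_iSup (fun S : G.Scramble => S.order) G.edgeScramble)

end SimpleGraph

theorem mainTheorem3 {V : Type*} [Fintype V] [DecidableEq V]
    (G : SimpleGraph V) [DecidableRel G.Adj]
    (hcard : 2 ≤ Fintype.card V)
    (hadj : ∀ u v : V, G.Adj u v → Fintype.card V ≤ G.degree u + G.degree v)
    (hnonadj : ∀ u v : V, u ≠ v → ¬ G.Adj u v →
      Fintype.card V + 1 ≤ G.degree u + G.degree v) :
    G.scrambleNumber = (G.gonality : ℕ∞) ∧
      (G.gonality : ℤ) = (Fintype.card V : ℤ) - (G.indepNum : ℤ) := by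
  have : Nonempty V := Fintype.card_pos_iff.1 (by omega)
  have hdeg : ∀ v, 0 < G.degree v := by
    intro v
    by_contra hv
    have : Nontrivial V := Fintype.one_lt_card_iff_nontrivial.1 (by omega)
    obtain ⟨w, hw⟩ := exists_ne v
    have hna : ¬ G.Adj v w := fun h => hv ((G.degree_pos_iff_exists_adj v).2 ⟨w, h⟩)
    have h1 := hnonadj v w hw.symm hna
    have h2 := G.degree_lt_card_verts w
    omega
  have hind : G.indepNum ≤ Fintype.card V := by
    obtain ⟨I, hI⟩ := G.exists_isNIndepSet_indepNum
    rw [← hI.card_eq]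
    exact Finset.card_le_univ I
  have h1 := SimpleGraph.card_sub_indepNum_le_scrambleNumber hadj hnonadj
  have h2 := SimpleGraph.scrambleNumber_le_gonality hdeg
  have h3 := SimpleGraph.gonality_le hdeg
  have h4 : Fintype.card V - G.indepNum ≤ G.gonality := Nat.cast_le.1 (h1.trans h2)
  refine ⟨le_antisymm h2 ((Nat.cast_le.2 h3).trans h1), ?_⟩
  omega
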